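/- Let $n,k,\ell$ be natural numbers with $k\ge 2$ even, $\ell\ge k/2$ and $n>k^2\ell$. Let $z\in\{\pm1\}^n$, and write $z_S=\prod_{i\in S}z_i$ for $S\subseteq[n]$. Let $$\mathcal K^*=\sum_{S\in\binom{[n]}{k}} z_S\sum_{U,W\in\binom{[n]}{\ell}}|U\rangle\langle W|\,\mathbf 1(U\,\Delta\, W=S)$$ be the noiseless Kikuchi matrix of order $\ell$, a real matrix indexed by the $\ell$-element subsets of $[n]$. For $v\in\mathbb R^{\binom{[n]}{\ell}}$ let $V=V(v)\in\mathbb R^{n\times n}$ be the voting matrix $$V_{ij}=\tfrac12\sum_{U,W\in\binom{[n]}{\ell}}v_Uv_W\,\mathbf 1(U\,\Delta\, W=\{i,j\})\quad(i\ne j),\qquad V_{ii}=0.$$ Then for every $v$ with $\|v\|_2=1$, $$z^{\mathsf T}Vz\;\ge\; n\,\frac{\langle v|\mathcal K^*|v\rangle-(-1)^{k/2}\binom{\ell}{k/2}}{\binom{n-\ell}{k/2}\binom{\ell}{k/2}-(-1)^{k/2}\binom{\ell}{k/2}}-\ell .$$ -/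

import Mathlib

open scoped symmDiff Matrix

noncomputable section

/-- The `ℓ`-element subsets of `[n]`. -/
abbrev LSubset (n ℓ : ℕ) : Type := {U : Finset (Fin n) // U.card = ℓ}

/-- The matrix `∑_{U, V} |U⟩⟨V| 1(U ∆ V = S)`, with `U, V` ranging over the `ℓ`-subsets of `[n]`. -/
def kikuchiTerm {n : ℕ} (ℓ : ℕ) (S : Finset (Fin n)) : Matrix (LSubset n ℓ) (LSubset n ℓ) ℝ :=
  Matrix.of fun U V => if (U : Finset (Fin n)) ∆ (V : Finset (Fin n)) = S then 1 else 0

/-- The noiseless Kikuchi matrix of order `ℓ` of the spike `z`: the sum over all `k`-subsets `S`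
of `[n]` of `z_S ∑_{U, V} |U⟩⟨V| 1(U ∆ V = S)`, where `z_S = ∏_{i ∈ S} z_i`. -/
def noiselessKikuchi {n : ℕ} (k ℓ : ℕ) (z : Fin n → ℝ) :
    Matrix (LSubset n ℓ) (LSubset n ℓ) ℝ :=
  ∑ S ∈ (Finset.univ : Finset (Fin n)).powersetCard k, (∏ i ∈ S, z i) • kikuchiTerm ℓ S

/-- The voting matrix of a vector `v` indexed by the `ℓ`-subsets of `[n]`: off the diagonal, its
entry at `(i, j)` is the sum of `v_U v_W` over the unordered pairs `{U, W}` with `U ∆ W = {i, j}`,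
that is, half the sum over the ordered pairs; the diagonal entries are zero. -/
def votingMatrix {n ℓ : ℕ} (v : LSubset n ℓ → ℝ) : Matrix (Fin n) (Fin n) ℝ :=
  Matrix.of fun i j =>
    if i ≠ j then
      (1 / 2 : ℝ) * ∑ U : LSubset n ℓ, ∑ W : LSubset n ℓ,
        v U * v W * (if (U : Finset (Fin n)) ∆ (W : Finset (Fin n)) = {i, j} then 1 else 0)
    else 0

end

/-! Since `z_{U∆W} = z_U z_W`, putting `x_U = z_U v_U` removes the spike: both quadratic forms
become Johnson-scheme forms of `x`, at distances `k/2` and `1`. Write `m = k/2` and `E_i = upEnergy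
x i`. Inclusion–exclusion gives `J_m = ∑_t (-1)^(m-t) C(ℓ-t, m-t) E_{ℓ-t}`
(`johnsonForm_eq_sum_upEnergy`). The term `t = 0` is the constant subtracted in the numerator, as
`E_ℓ = 1`, and `J_1 = E_{ℓ-1} - ℓ`.

For `t ≥ 1` the signs are dropped and Cauchy–Schwarz (`upEnergy_le_succ`), iterated, bounds each
`E_{ℓ-t}` by a multiple of `E_{ℓ-1}`. It remains to check that `n` times the total coefficient is at
most the denominator; this is where `n > k²ℓ` enters (`mul_sum_energyBound_le`). -/

/-! ### Energies of containment sums -/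

/-- The sum of `x U` over the `ℓ`-subsets `U` of `[n]` that contain `T`. -/
noncomputable def upSum {n ℓ : ℕ} (x : LSubset n ℓ → ℝ) (T : Finset (Fin n)) : ℝ :=
  ∑ U : LSubset n ℓ, if T ⊆ (U : Finset (Fin n)) then x U else 0

/-- The sum of the squares of the sums `upSum x T` over all `i`-subsets `T` of `[n]`. -/
noncomputable def upEnergy {n ℓ : ℕ} (x : LSubset n ℓ → ℝ) (i : ℕ) : ℝ :=
  ∑ T ∈ (Finset.univ : Finset (Fin n)).powersetCard i, upSum x T ^ 2

/-- The quadratic form of the `m`-th adjacency matrix of the Johnson scheme. -/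
noncomputable def johnsonForm {n ℓ : ℕ} (x : LSubset n ℓ → ℝ) (m : ℕ) : ℝ :=
  ∑ U : LSubset n ℓ, ∑ W : LSubset n ℓ,
    x U * x W * if ((U : Finset (Fin n)) ∆ (W : Finset (Fin n))).card = 2 * m then 1 else 0

theorem upEnergy_nonneg {n ℓ : ℕ} (x : LSubset n ℓ → ℝ) (i : ℕ) : 0 ≤ upEnergy x i :=
  Finset.sum_nonneg fun _ _ => sq_nonneg _

/-- Expanding the square, a pair `U, W` is counted once for each `T ⊆ U ∩ W`. -/
theorem upEnergy_eq_sum_choose {n ℓ : ℕ} (x : LSubset n ℓ → ℝ) (i : ℕ) :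
    upEnergy x i = ∑ U : LSubset n ℓ, ∑ W : LSubset n ℓ,
      x U * x W * (((U : Finset (Fin n)) ∩ (W : Finset (Fin n))).card.choose i : ℝ) := by
  have h (U W : LSubset n ℓ) :
      (((U : Finset (Fin n)) ∩ (W : Finset (Fin n))).card.choose i : ℝ) =
        ∑ T ∈ (Finset.univ : Finset (Fin n)).powersetCard i,
          if T ⊆ (U : Finset (Fin n)) ∧ T ⊆ (W : Finset (Fin n)) then (1 : ℝ) else 0 := by
    rw [← Finset.card_powersetCard, Finset.sum_boole]
    congr 2
    ext T
    simp only [Finset.mem_powersetCard, Finset.mem_filter, Finset.subset_inter_iff,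
      Finset.subset_univ, true_and]
    tauto
  simp_rw [h, Finset.mul_sum, upEnergy, upSum, sq, Finset.sum_mul_sum]
  rw [Finset.sum_comm]
  refine Finset.sum_congr rfl fun U _ => ?_
  rw [Finset.sum_comm]
  refine Finset.sum_congr rfl fun W _ => Finset.sum_congr rfl fun T _ => ?_
  by_cases h1 : T ⊆ (U : Finset (Fin n)) <;> by_cases h2 : T ⊆ (W : Finset (Fin n)) <;>
    simp [h1, h2]

theorem upEnergy_self {n ℓ : ℕ} (x : LSubset n ℓ → ℝ) : upEnergy x ℓ = ∑ U, x U ^ 2 := by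
  rw [upEnergy_eq_sum_choose]
  refine Finset.sum_congr rfl fun U _ => ?_
  rw [Finset.sum_eq_single U]
  · rw [Finset.inter_self, U.2, Nat.choose_self]
    push_cast
    ring
  · intro W _ hW
    rw [Nat.choose_eq_zero_of_lt, Nat.cast_zero, mul_zero]
    refine (lt_of_le_of_ne (Finset.card_le_card Finset.inter_subset_left)
      fun he => hW ?_).trans_eq U.2
    have h1 := Finset.eq_of_subset_of_card_le Finset.inter_subset_left he.ge
    exact Subtype.ext (Finset.eq_of_subset_of_card_le (Finset.inter_eq_left.mp h1)
      (by rw [U.2, W.2])).symm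
  · simp

/-! ### Johnson forms by binomial inversion -/

/-- With `r = ℓ - m` and `j = m - t`, `C(a, r+j) C(r+j, r) = C(a, r) C(a-r, j)` leaves the
alternating sum of row `a - r`. That row is complete because `a ≤ ℓ`. -/
theorem sum_neg_one_pow_choose_mul_choose (ℓ m a : ℕ) (hm : m ≤ ℓ) (ha : a ≤ ℓ) :
    ∑ t ∈ Finset.range (m + 1),
        (-1 : ℝ) ^ (m - t) * ((ℓ - t).choose (m - t) : ℝ) * (a.choose (ℓ - t) : ℝ) =
      if a = ℓ - m then 1 else 0 := by
  obtain ⟨r, rfl⟩ := Nat.exists_eq_add_of_le' hm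
  rw [← Finset.sum_range_reflect]
  have h : ∀ j ∈ Finset.range (m + 1),
      (-1 : ℝ) ^ (m - (m + 1 - 1 - j)) *
          ((r + m - (m + 1 - 1 - j)).choose (m - (m + 1 - 1 - j)) : ℝ) *
          (a.choose (r + m - (m + 1 - 1 - j)) : ℝ) =
        (a.choose r : ℝ) * ((-1 : ℝ) ^ j * ((a - r).choose j : ℝ)) := by
    intro j hj
    rw [Finset.mem_range] at hj
    rw [show m - (m + 1 - 1 - j) = j by omega, show r + m - (m + 1 - 1 - j) = r + j by omega]
    have h1 : a.choose (r + j) * (r + j).choose r = a.choose r * (a - r).choose j := by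
      by_cases hle : r + j ≤ a
      · rw [Nat.choose_mul (by omega), Nat.add_sub_cancel_left]
      · rw [Nat.choose_eq_zero_of_lt (by omega : a < r + j), zero_mul]
        by_cases hr : r ≤ a
        · rw [Nat.choose_eq_zero_of_lt (by omega : a - r < j), mul_zero]
        · rw [Nat.choose_eq_zero_of_lt (by omega : a < r), zero_mul]
    have h2 : (r + j).choose j = (r + j).choose r := by
      rw [Nat.choose_symm_add]
    have h3 : (a.choose (r + j) : ℝ) * ((r + j).choose r : ℝ) =
        (a.choose r : ℝ) * ((a - r).choose j : ℝ) := by exact_mod_cast h1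
    rw [h2]
    linear_combination (-1 : ℝ) ^ j * h3
  rw [Finset.sum_congr rfl h, ← Finset.mul_sum, Nat.add_sub_cancel]
  by_cases hr : r ≤ a
  · have h4 : ∑ j ∈ Finset.range (m + 1), (-1 : ℝ) ^ j * ((a - r).choose j : ℝ) =
        if a - r = 0 then 1 else 0 := by
      rw [← Finset.sum_subset (s₁ := Finset.range (a - r + 1))]
      · have := Int.alternating_sum_range_choose (n := a - r)
        exact_mod_cast this
      · intro j hj
        rw [Finset.mem_range] at *
        omega
      · intro j _ hj
        rw [Finset.mem_range] at hj
        rw [Nat.choose_eq_zero_of_lt (by omega), Nat.cast_zero, mul_zero]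
    rw [h4]
    by_cases har : a = r
    · simp [har]
    · rw [if_neg har, if_neg (by omega), mul_zero]
  · rw [if_neg (by omega), Nat.choose_eq_zero_of_lt (by omega : a < r), Nat.cast_zero, zero_mul]

theorem card_symmDiff_eq_iff {n ℓ m : ℕ} (hm : m ≤ ℓ) (U W : LSubset n ℓ) :
    ((U : Finset (Fin n)) ∆ (W : Finset (Fin n))).card = 2 * m ↔
      ((U : Finset (Fin n)) ∩ (W : Finset (Fin n))).card = ℓ - m := by
  have h1 := Finset.card_sdiff_add_card_inter (U : Finset (Fin n)) (W : Finset (Fin n))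
  have h2 := Finset.card_sdiff_add_card_inter (W : Finset (Fin n)) (U : Finset (Fin n))
  have h3 : ((U : Finset (Fin n)) ∆ (W : Finset (Fin n))).card =
      ((U : Finset (Fin n)) \ (W : Finset (Fin n))).card +
        ((W : Finset (Fin n)) \ (U : Finset (Fin n))).card := by
    rw [symmDiff_def, Finset.sup_eq_union, Finset.card_union_of_disjoint disjoint_sdiff_sdiff]
  rw [Finset.inter_comm] at h2
  rw [U.2] at h1
  rw [W.2] at h2
  omega

theorem johnsonForm_eq_sum_upEnergy {n ℓ m : ℕ} (hm : m ≤ ℓ) (x : LSubset n ℓ → ℝ) :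
    johnsonForm x m = ∑ t ∈ Finset.range (m + 1),
      (-1 : ℝ) ^ (m - t) * ((ℓ - t).choose (m - t) : ℝ) * upEnergy x (ℓ - t) := by
  simp_rw [upEnergy_eq_sum_choose, Finset.mul_sum]
  rw [Finset.sum_comm]
  refine Finset.sum_congr rfl fun U _ => ?_
  rw [Finset.sum_comm]
  refine Finset.sum_congr rfl fun W _ => ?_
  have hcard : ((U : Finset (Fin n)) ∩ (W : Finset (Fin n))).card ≤ ℓ :=
    (Finset.card_le_card Finset.inter_subset_left).trans U.2.le
  simp_rw [card_symmDiff_eq_iff hm]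
  rw [← sum_neg_one_pow_choose_mul_choose ℓ m _ hm hcard, Finset.mul_sum]
  exact Finset.sum_congr rfl fun t _ => by ring

/-! ### Comparing consecutive energies -/

theorem sum_upSum_insert {n ℓ : ℕ} (x : LSubset n ℓ → ℝ) (T : Finset (Fin n)) :
    ∑ a ∈ Tᶜ, upSum x (insert a T) = ((ℓ : ℝ) - T.card) * upSum x T := by
  unfold upSum
  rw [Finset.sum_comm, Finset.mul_sum]
  refine Finset.sum_congr rfl fun U _ => ?_
  by_cases h : T ⊆ (U : Finset (Fin n))
  · simp only [Finset.insert_subset_iff, h, and_true, if_true]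
    rw [← Finset.sum_filter, Finset.sum_const, nsmul_eq_mul]
    congr 1
    have h1 : Tᶜ.filter (fun a => a ∈ (U : Finset (Fin n))) = (U : Finset (Fin n)) \ T := by
      ext a
      simp [and_comm]
    rw [h1, Finset.card_sdiff_of_subset h, Nat.cast_sub (Finset.card_le_card h), U.2]
  · simp [Finset.insert_subset_iff, h]

theorem sum_sum_insert_powersetCard {n : ℕ} (i : ℕ) (f : Finset (Fin n) → ℝ) :
    ∑ T ∈ (Finset.univ : Finset (Fin n)).powersetCard i, ∑ a ∈ Tᶜ, f (insert a T) =
      ((i : ℝ) + 1) * ∑ P ∈ (Finset.univ : Finset (Fin n)).powersetCard (i + 1), f P := by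
  have h : ((i : ℝ) + 1) * ∑ P ∈ (Finset.univ : Finset (Fin n)).powersetCard (i + 1), f P =
      ∑ P ∈ (Finset.univ : Finset (Fin n)).powersetCard (i + 1), ∑ a ∈ P, f P := by
    rw [Finset.mul_sum]
    refine Finset.sum_congr rfl fun P hP => ?_
    rw [Finset.sum_const, (Finset.mem_powersetCard.mp hP).2, nsmul_eq_mul]
    push_cast
    ring
  rw [h, Finset.sum_sigma', Finset.sum_sigma']
  refine Finset.sum_bij' (fun p _ => ⟨insert p.2 p.1, p.2⟩) (fun p _ => ⟨p.1.erase p.2, p.2⟩)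
    ?_ ?_ ?_ ?_ ?_
  · rintro ⟨T, a⟩ hp
    simp only [Finset.mem_sigma, Finset.mem_powersetCard, Finset.mem_compl] at hp ⊢
    exact ⟨⟨Finset.subset_univ _, by rw [Finset.card_insert_of_notMem hp.2, hp.1.2]⟩,
      Finset.mem_insert_self _ _⟩
  · rintro ⟨P, a⟩ hp
    simp only [Finset.mem_sigma, Finset.mem_powersetCard, Finset.mem_compl] at hp ⊢
    exact ⟨⟨Finset.subset_univ _, by rw [Finset.card_erase_of_mem hp.2, hp.1.2]; rfl⟩,
      Finset.notMem_erase _ _⟩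
  · rintro ⟨T, a⟩ hp
    simp only [Finset.mem_sigma, Finset.mem_compl] at hp
    simp [Finset.erase_insert hp.2]
  · rintro ⟨P, a⟩ hp
    simp only [Finset.mem_sigma] at hp
    simp [Finset.insert_erase hp.2]
  · intros
    rfl

/-- Cauchy–Schwarz over the `n - i` one-point extensions of each `T`; each `(i+1)`-set arises from
`i + 1` such `T`. -/
theorem upEnergy_le_succ {n ℓ i : ℕ} (hi : i ≤ n) (x : LSubset n ℓ → ℝ) :
    ((ℓ : ℝ) - i) ^ 2 * upEnergy x i ≤ ((i : ℝ) + 1) * ((n : ℝ) - i) * upEnergy x (i + 1) := by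
  have h : ∀ T ∈ (Finset.univ : Finset (Fin n)).powersetCard i,
      ((ℓ : ℝ) - i) ^ 2 * upSum x T ^ 2 ≤
        ((n : ℝ) - i) * ∑ a ∈ Tᶜ, upSum x (insert a T) ^ 2 := by
    intro T hT
    have hc := (Finset.mem_powersetCard.mp hT).2
    have h1 := sum_upSum_insert x T
    have h2 := sq_sum_le_card_mul_sum_sq (s := Tᶜ) (f := fun a => upSum x (insert a T))
    rw [h1, Finset.card_compl, Fintype.card_fin, hc, Nat.cast_sub hi, mul_pow] at h2
    exact h2
  have h3 := Finset.sum_le_sum h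
  rw [← Finset.mul_sum, ← Finset.mul_sum,
    sum_sum_insert_powersetCard i (fun P => upSum x P ^ 2)] at h3
  unfold upEnergy
  linarith

/-! ### Removing the spike -/

theorem prod_symmDiff_of_sq_eq_one {n : ℕ} {z : Fin n → ℝ} (hz : ∀ i, z i = 1 ∨ z i = -1)
    (U W : Finset (Fin n)) :
    ∏ i ∈ U ∆ W, z i = (∏ i ∈ U, z i) * ∏ i ∈ W, z i := by
  have h1 : ∏ i ∈ U ∆ W, z i = (∏ i ∈ U \ W, z i) * ∏ i ∈ W \ U, z i := by
    rw [symmDiff_def, Finset.sup_eq_union, Finset.prod_union disjoint_sdiff_sdiff]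
  have h2 := Finset.prod_inter_mul_prod_sdiff U W z
  have h3 := Finset.prod_inter_mul_prod_sdiff W U z
  rw [Finset.inter_comm] at h3
  have h4 : (∏ i ∈ U ∩ W, z i) * ∏ i ∈ U ∩ W, z i = 1 := by
    rw [← Finset.prod_mul_distrib]
    refine Finset.prod_eq_one fun i _ => ?_
    rcases hz i with h | h <;> simp [h]
  rw [h1, ← h2, ← h3]
  linear_combination (-(∏ i ∈ U \ W, z i) * ∏ i ∈ W \ U, z i) * h4

theorem dotProduct_noiselessKikuchi_mulVec {n ℓ : ℕ} (m : ℕ) {z : Fin n → ℝ}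
    (hz : ∀ i, z i = 1 ∨ z i = -1) (v : LSubset n ℓ → ℝ) :
    v ⬝ᵥ (noiselessKikuchi (2 * m) ℓ z *ᵥ v) =
      johnsonForm (fun U => (∏ i ∈ (U : Finset (Fin n)), z i) * v U) m := by
  have hent (U W : LSubset n ℓ) : noiselessKikuchi (2 * m) ℓ z U W =
      if ((U : Finset (Fin n)) ∆ (W : Finset (Fin n))).card = 2 * m then
        ∏ i ∈ (U : Finset (Fin n)) ∆ (W : Finset (Fin n)), z i else 0 := by
    simp [noiselessKikuchi, kikuchiTerm, Matrix.sum_apply, Finset.mem_powersetCard]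
  simp only [dotProduct, Matrix.mulVec, johnsonForm, hent, Finset.mul_sum]
  refine Finset.sum_congr rfl fun U _ => Finset.sum_congr rfl fun W _ => ?_
  rw [prod_symmDiff_of_sq_eq_one hz]
  split_ifs <;> ring

/-- The two orderings of a pair give the factor 2, which cancels the `1/2` in `votingMatrix`. -/
theorem sum_sum_pair_eq {n : ℕ} (z : Fin n → ℝ) (A : Finset (Fin n)) :
    ∑ i, ∑ j, (if i ≠ j then z i * z j * (if A = {i, j} then 1 else 0) else 0) =
      2 * if A.card = 2 then ∏ i ∈ A, z i else 0 := by
  by_cases hA : A.card = 2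
  · have h1 (i j : Fin n) : (if i ≠ j then z i * z j * (if A = {i, j} then 1 else 0) else 0) =
        if (i, j) ∈ A.offDiag then ∏ i ∈ A, z i else 0 := by
      by_cases hij : i = j
      · simp [hij]
      · by_cases h : A = {i, j}
        · subst h
          simp [hij, Finset.prod_pair hij]
        · have h2 : (i, j) ∉ A.offDiag := by
            intro hm
            rw [Finset.mem_offDiag] at hm
            refine h (Finset.eq_of_subset_of_card_le ?_ ?_).symm
            · simp only [Finset.insert_subset_iff, Finset.singleton_subset_iff]
              exact ⟨hm.1, hm.2.1⟩
            · rw [hA, Finset.card_pair hij]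
          rw [if_neg h2]
          simp [h]
    simp_rw [h1]
    rw [← Fintype.sum_prod_type' (f := fun i j => if (i, j) ∈ A.offDiag then ∏ i ∈ A, z i else 0)]
    rw [← Finset.sum_filter, Finset.filter_mem_eq_inter, Finset.univ_inter, Finset.sum_const,
      Finset.offDiag_card, hA, if_pos rfl, nsmul_eq_mul]
    norm_num
  · rw [if_neg hA, mul_zero]
    refine Finset.sum_eq_zero fun i _ => Finset.sum_eq_zero fun j _ => ?_
    by_cases hij : i = j
    · simp [hij]
    · rw [if_pos hij, if_neg, mul_zero]
      rintro rfl
      exact hA (Finset.card_pair hij)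

theorem dotProduct_votingMatrix_mulVec {n ℓ : ℕ} {z : Fin n → ℝ}
    (hz : ∀ i, z i = 1 ∨ z i = -1) (v : LSubset n ℓ → ℝ) :
    z ⬝ᵥ (votingMatrix v *ᵥ z) =
      johnsonForm (fun U => (∏ i ∈ (U : Finset (Fin n)), z i) * v U) 1 := by
  have h1 : z ⬝ᵥ (votingMatrix v *ᵥ z) = ∑ i, ∑ j, ∑ U : LSubset n ℓ, ∑ W : LSubset n ℓ,
      (1 / 2 : ℝ) * (v U * v W) * (if i ≠ j then z i * z j *
        (if (U : Finset (Fin n)) ∆ (W : Finset (Fin n)) = {i, j} then 1 else 0) else 0) := by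
    simp only [dotProduct, Matrix.mulVec, votingMatrix, Matrix.of_apply, Finset.mul_sum]
    refine Finset.sum_congr rfl fun i _ => Finset.sum_congr rfl fun j _ => ?_
    by_cases hij : i = j
    · simp [hij]
    · simp only [ne_eq, hij, not_false_eq_true, if_true, Finset.mul_sum, Finset.sum_mul]
      refine Finset.sum_congr rfl fun U _ => Finset.sum_congr rfl fun W _ => ?_
      ring
  have h2 : z ⬝ᵥ (votingMatrix v *ᵥ z) = ∑ U : LSubset n ℓ, ∑ W : LSubset n ℓ,
      (1 / 2 : ℝ) * (v U * v W) * ∑ i, ∑ j, (if i ≠ j then z i * z j *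
        (if (U : Finset (Fin n)) ∆ (W : Finset (Fin n)) = {i, j} then 1 else 0) else 0) := by
    rw [h1]
    simp_rw [Finset.mul_sum]
    rw [Finset.sum_congr rfl fun i _ => Finset.sum_comm, Finset.sum_comm]
    refine Finset.sum_congr rfl fun U _ => ?_
    rw [Finset.sum_congr rfl fun i _ => Finset.sum_comm, Finset.sum_comm]
  rw [h2, johnsonForm]
  refine Finset.sum_congr rfl fun U _ => Finset.sum_congr rfl fun W _ => ?_
  rw [sum_sum_pair_eq, prod_symmDiff_of_sq_eq_one hz]
  split_ifs <;> ring

/-! ### Numerical bounds on the coefficients -/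

/-- The factor by which `upEnergy x (ℓ - (u + 1))` is bounded in terms of `upEnergy x (ℓ - 1)`,
for `ℓ`-subsets of a set of size `N + ℓ`. -/
noncomputable def energyBound (ℓ N u : ℕ) : ℝ :=
  ((ℓ - 1).choose u : ℝ) * ((N + u + 1).choose u : ℝ) / ((u : ℝ) + 1) ^ 2

theorem energyBound_nonneg (ℓ N u : ℕ) : 0 ≤ energyBound ℓ N u := by
  unfold energyBound
  positivity

/-- This is the recursion produced by `upEnergy_le_succ` at `i = ℓ - (u + 2)`, where `n - i = N + u
+ 2`. -/
theorem energyBound_succ {ℓ u : ℕ} (N : ℕ) (hu : u + 1 ≤ ℓ) :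
    energyBound ℓ N (u + 1) * ((u : ℝ) + 2) ^ 2 =
      ((ℓ : ℝ) - u - 1) * ((N : ℝ) + u + 2) * energyBound ℓ N u := by
  obtain ⟨p, rfl⟩ := Nat.exists_eq_add_of_le' hu
  have h1 := Nat.choose_succ_right_eq (p + u) u
  have h2 := Nat.add_one_mul_choose_eq (N + u + 1) u
  rw [Nat.add_sub_cancel] at h1
  have h1' : ((p + u).choose (u + 1) : ℝ) * ((u : ℝ) + 1) = ((p + u).choose u : ℝ) * p := by
    exact_mod_cast h1
  have h2' : ((N : ℝ) + u + 2) * ((N + u + 1).choose u : ℝ) =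
      ((N + u + 2).choose (u + 1) : ℝ) * ((u : ℝ) + 1) := by
    exact_mod_cast h2
  unfold energyBound
  rw [show p + (u + 1) - 1 = p + u by omega, show N + (u + 1) + 1 = N + u + 2 by omega]
  have e1 : ((p + u).choose (u + 1) : ℝ) = ((p + u).choose u : ℝ) * p / ((u : ℝ) + 1) := by
    rw [eq_div_iff (by positivity), h1']
  have e2 : ((N + u + 2).choose (u + 1) : ℝ) =
      ((N : ℝ) + u + 2) * ((N + u + 1).choose u : ℝ) / ((u : ℝ) + 1) := by
    rw [eq_div_iff (by positivity), h2']
  rw [e1, e2]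
  push_cast
  have e3 : (u : ℝ) + 1 + 1 ≠ 0 := by positivity
  have e4 : (u : ℝ) + 1 ≠ 0 := by positivity
  field_simp
  ring

theorem upEnergy_le_energyBound_mul {ℓ N u : ℕ} (x : LSubset (N + ℓ) ℓ → ℝ)
    (hu : u + 1 ≤ ℓ) : upEnergy x (ℓ - (u + 1)) ≤ energyBound ℓ N u * upEnergy x (ℓ - 1) := by
  induction u with
  | zero => simp [energyBound]
  | succ u ih =>
    have h1 := upEnergy_le_succ (i := ℓ - (u + 1 + 1)) (by omega) x
    rw [show ℓ - (u + 1 + 1) + 1 = ℓ - (u + 1) by omega, Nat.cast_sub hu] at h1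
    have h2 := energyBound_succ N (by omega : u + 1 ≤ ℓ)
    have h3 := ih (by omega)
    have hu' : (u : ℝ) + 2 ≤ ℓ := by exact_mod_cast hu
    have h4 := mul_le_mul_of_nonneg_left h3
      (by have : (0 : ℝ) ≤ N + u + 2 := by positivity
          exact mul_nonneg (by linarith) this : 0 ≤ ((ℓ : ℝ) - u - 1) * ((N : ℝ) + u + 2))
    have h5 : (0 : ℝ) < ((u : ℝ) + 2) ^ 2 := by positivity
    refine le_of_mul_le_mul_left ?_ h5
    push_cast at h1
    linear_combination h1 + h4 - upEnergy x (ℓ - 1) * h2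

/-- Consecutive terms grow by a factor of at least `N / m² ≥ 15/2`, so the sum is at most `1 / (1 -
2/15) = 15/13` times its last term. -/
theorem sum_energyBound_le {ℓ m N : ℕ} (hm : 2 ≤ m) (hmℓ : m ≤ ℓ)
    (hN : 15 / 2 * (m : ℝ) ^ 2 ≤ N) {p : ℕ} (hp : p + 1 ≤ m) :
    ∑ u ∈ Finset.range (p + 1), ((ℓ - (u + 1)).choose (m - (u + 1)) : ℝ) * energyBound ℓ N u ≤
      15 / 13 * (((ℓ - (p + 1)).choose (m - (p + 1)) : ℝ) * energyBound ℓ N p) := by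
  induction p with
  | zero =>
    rw [Finset.sum_range_one]
    have := mul_nonneg (Nat.cast_nonneg (α := ℝ) ((ℓ - (0 + 1)).choose (m - (0 + 1))))
      (energyBound_nonneg ℓ N 0)
    linarith
  | succ p ih =>
    rw [Finset.sum_range_succ]
    have h1 := ih (by omega)
    have h2 := energyBound_succ N (by omega : p + 1 ≤ ℓ)
    have h3 := Nat.add_one_mul_choose_eq (ℓ - (p + 1 + 1)) (m - (p + 1 + 1))
    rw [show ℓ - (p + 1 + 1) + 1 = ℓ - (p + 1) by omega,
      show m - (p + 1 + 1) + 1 = m - (p + 1) by omega] at h3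
    have h4 : ((ℓ : ℝ) - p - 1) * ((ℓ - (p + 1 + 1)).choose (m - (p + 1 + 1)) : ℝ) =
        ((ℓ - (p + 1)).choose (m - (p + 1)) : ℝ) * ((m : ℝ) - p - 1) := by
      have := congrArg (Nat.cast (R := ℝ)) h3
      rw [Nat.cast_mul, Nat.cast_mul, Nat.cast_sub (by omega), Nat.cast_sub (by omega)] at this
      push_cast at this
      linear_combination this
    set a := ((ℓ - (p + 1)).choose (m - (p + 1)) : ℝ)
    set b := ((ℓ - (p + 1 + 1)).choose (m - (p + 1 + 1)) : ℝ)
    set G := a * energyBound ℓ N p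
    set H := b * energyBound ℓ N (p + 1)
    have hG : 0 ≤ G := mul_nonneg (Nat.cast_nonneg _) (energyBound_nonneg _ _ _)
    have hH : 0 ≤ H := mul_nonneg (Nat.cast_nonneg _) (energyBound_nonneg _ _ _)
    have h5 : H * ((p : ℝ) + 2) ^ 2 = ((m : ℝ) - p - 1) * ((N : ℝ) + p + 2) * G := by
      simp only [G, H]
      linear_combination b * h2 + ((N : ℝ) + p + 2) * energyBound ℓ N p * h4
    have hp' : (p : ℝ) + 2 ≤ m := by exact_mod_cast hp
    have hp0 : (0 : ℝ) ≤ p := Nat.cast_nonneg p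
    have h6 : ((p : ℝ) + 2) ^ 2 ≤ (m : ℝ) ^ 2 := by gcongr
    have h7 : (N : ℝ) ≤ ((m : ℝ) - p - 1) * ((N : ℝ) + p + 2) := by
      have : (0 : ℝ) ≤ ((m : ℝ) - p - 2) * ((N : ℝ) + p + 2) :=
        mul_nonneg (by linarith) (by positivity)
      linarith
    have h8 : (m : ℝ) ^ 2 * (15 / 2 * G) ≤ (m : ℝ) ^ 2 * H := by
      have e1 := mul_le_mul_of_nonneg_right hN hG
      have e2 := mul_le_mul_of_nonneg_right h7 hG
      have e3 := mul_le_mul_of_nonneg_left h6 hH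
      linarith
    have h9 := le_of_mul_le_mul_left h8 (by positivity)
    linarith

/-- Pascal's rule `j` times, each increment being at most `C(N+m, m)`. -/
theorem choose_add_le (N m j : ℕ) (hj : j ≤ m + 1) :
    (N + j).choose (m + 1) ≤ N.choose (m + 1) + j * (N + m).choose m := by
  induction j with
  | zero => simp
  | succ j ih =>
    have h1 := ih (by omega)
    have h2 : (N + j).choose m ≤ (N + m).choose m := Nat.choose_le_choose _ (by omega)
    rw [← Nat.add_assoc, Nat.choose_succ_succ]
    linarith

theorem mul_sum_energyBound_le {ℓ m N : ℕ} (hm : 0 < m) (hmℓ : m ≤ ℓ)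
    (hN : (2 * m) ^ 2 * ℓ < N + ℓ) :
    ((N : ℝ) + ℓ) * ∑ u ∈ Finset.range m,
        ((ℓ - (u + 1)).choose (m - (u + 1)) : ℝ) * energyBound ℓ N u ≤
      (N.choose m : ℝ) * (ℓ.choose m : ℝ) - (-1 : ℝ) ^ m * (ℓ.choose m : ℝ) := by
  -- The case `m = 1` allows `ℓ = 1`, where the bound is an equality; the estimates below need `m, ℓ
  -- ≥ 2`.
  obtain rfl | hm2 : m = 1 ∨ 2 ≤ m := by omega
  · have h1 : (1 : ℝ) ≤ ℓ := by exact_mod_cast hmℓ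
    have h2 : (0 : ℝ) ≤ N := Nat.cast_nonneg N
    simp only [Finset.sum_range_one, energyBound, Nat.choose_one_right]
    simp
    nlinarith
  have hN' : 4 * (m : ℝ) ^ 2 * ℓ < N + ℓ := by
    have : ((2 * m : ℝ)) ^ 2 * ℓ < N + ℓ := by exact_mod_cast hN
    linarith
  have hm' : (2 : ℝ) ≤ m := by exact_mod_cast hm2
  have hℓ' : (2 : ℝ) ≤ ℓ := by exact_mod_cast hm2.trans hmℓ
  have hmsq : (4 : ℝ) ≤ (m : ℝ) ^ 2 := by nlinarith
  -- From `m ≥ 2`, `ℓ ≤ m²ℓ/4`, so `4m²ℓ - ℓ ≥ (15/4) m²ℓ`; the next two bounds use `ℓ ≥ 2` and `m²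
  -- ≥ 4`.
  have hN1 : 15 / 4 * (m : ℝ) ^ 2 * ℓ ≤ N := by nlinarith
  have hN2 : 15 / 2 * (m : ℝ) ^ 2 ≤ N := by nlinarith
  have hN3 : 15 * (ℓ : ℝ) ≤ N := by nlinarith
  obtain ⟨p, rfl⟩ := Nat.exists_eq_add_of_le' hm
  have hsum := sum_energyBound_le hm2 hmℓ hN2 (le_refl (p + 1))
  rw [Nat.sub_self, Nat.choose_zero_right, Nat.cast_one, one_mul] at hsum
  set S := ∑ u ∈ Finset.range (p + 1),
    ((ℓ - (u + 1)).choose (p + 1 - (u + 1)) : ℝ) * energyBound ℓ N u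
  set c := (ℓ.choose (p + 1) : ℝ) with hc
  set X := ((N + (p + 1)).choose (p + 1) : ℝ) with hX
  set Y := (N.choose (p + 1) : ℝ) with hY
  have hc0 : 0 ≤ c := Nat.cast_nonneg _
  have hX0 : 0 ≤ X := Nat.cast_nonneg _
  have hg : (ℓ : ℝ) * ((N : ℝ) + 1) * energyBound ℓ N p = c * X := by
    have h1 := Nat.add_one_mul_choose_eq (ℓ - 1) p
    rw [show ℓ - 1 + 1 = ℓ by omega] at h1
    have h2 := Nat.choose_succ_right_eq (N + (p + 1)) p
    rw [show N + (p + 1) - p = N + 1 by omega] at h2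
    have h1' : (ℓ : ℝ) * ((ℓ - 1).choose p : ℝ) = c * ((p : ℝ) + 1) := by
      rw [hc]
      exact_mod_cast h1
    have h2' : X * ((p : ℝ) + 1) = ((N + p + 1).choose p : ℝ) * ((N : ℝ) + 1) := by
      rw [hX]
      exact_mod_cast h2
    unfold energyBound
    rw [mul_div_assoc', div_eq_iff (by positivity)]
    linear_combination ((N : ℝ) + 1) * ((N + p + 1).choose p : ℝ) * h1' -
      c * ((p : ℝ) + 1) * h2'
  have hXY : 13 / 15 * X ≤ Y := by
    have h1 : X ≤ Y + ((p : ℝ) + 1) * ((N + p).choose p : ℝ) := by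
      rw [hX, hY]
      exact_mod_cast choose_add_le N p (p + 1) le_rfl
    have h2 : ((N : ℝ) + p + 1) * ((N + p).choose p : ℝ) = X * ((p : ℝ) + 1) := by
      rw [hX]
      exact_mod_cast Nat.add_one_mul_choose_eq (N + p) p
    push_cast at hN2
    have h3 : (0 : ℝ) < (N : ℝ) + p + 1 := by positivity
    have h4 : ((N : ℝ) + p + 1) * (((p : ℝ) + 1) * ((N + p).choose p : ℝ)) ≤
        ((N : ℝ) + p + 1) * (2 / 15 * X) := by
      have e1 : ((p : ℝ) + 1) ^ 2 ≤ 2 / 15 * ((N : ℝ) + p + 1) := by linarith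
      have e2 := mul_le_mul_of_nonneg_right e1 hX0
      linear_combination e2 + ((p : ℝ) + 1) * h2
    have h5 := le_of_mul_le_mul_left h4 h3
    linarith
  have hX1 : (N : ℝ) + 1 ≤ X := by
    have h1 : (N + 1).choose N ≤ (N + (p + 1)).choose N := Nat.choose_le_choose _ (by omega)
    rw [Nat.choose_succ_self_right, Nat.choose_symm_add] at h1
    rw [hX]
    exact_mod_cast h1
  have hsign : (-1 : ℝ) ^ (p + 1) ≤ 1 := by
    rcases neg_one_pow_eq_or ℝ (p + 1) with h | h <;> norm_num [h]
  have hg0 := energyBound_nonneg ℓ N p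
  have hmain : ((N : ℝ) + ℓ) * energyBound ℓ N p ≤ 8 / 15 * (c * X) := by
    -- `N + ℓ ≤ (16/15) N`, and `ℓ ≥ 2` halves the constant.
    have e1 : (N : ℝ) + ℓ ≤ 8 / 15 * (ℓ * ((N : ℝ) + 1)) := by nlinarith
    have e2 := mul_le_mul_of_nonneg_right e1 hg0
    linarith
  have h1 : ((N : ℝ) + ℓ) * S ≤ ((N : ℝ) + ℓ) * (15 / 13 * energyBound ℓ N p) :=
    mul_le_mul_of_nonneg_left hsum (by positivity)
  -- `8/13 = (15/13)(8/15)`; the gap `13/15 - 8/13` times `X ≥ N + 1 ≥ 31` absorbs the `1` coming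
  -- from the sign term.
  have h2 : 8 / 13 * X ≤ Y - 1 := by linarith
  have h3 := mul_le_mul_of_nonneg_left h2 hc0
  have h4 := mul_le_mul_of_nonneg_right hsign hc0
  linarith

/-! ### Assembling the inequality -/

theorem sum_signed_upEnergy_le {ℓ m N : ℕ} (hmℓ : m ≤ ℓ)
    (x : LSubset (N + ℓ) ℓ → ℝ) :
    johnsonForm x m - (-1 : ℝ) ^ m * (ℓ.choose m : ℝ) * upEnergy x ℓ ≤
      (∑ u ∈ Finset.range m,
        ((ℓ - (u + 1)).choose (m - (u + 1)) : ℝ) * energyBound ℓ N u) * upEnergy x (ℓ - 1) := by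
  rw [johnsonForm_eq_sum_upEnergy hmℓ, Finset.sum_range_succ', Finset.sum_mul]
  simp only [Nat.sub_zero, add_sub_cancel_right]
  refine Finset.sum_le_sum fun u hu => ?_
  rw [Finset.mem_range] at hu
  have hsign : (-1 : ℝ) ^ (m - (u + 1)) ≤ 1 := by
    rcases neg_one_pow_eq_or ℝ (m - (u + 1)) with h | h <;> norm_num [h]
  rw [mul_assoc, mul_assoc]
  calc _ ≤ 1 * (((ℓ - (u + 1)).choose (m - (u + 1)) : ℝ) * upEnergy x (ℓ - (u + 1))) :=
        mul_le_mul_of_nonneg_right hsign (mul_nonneg (Nat.cast_nonneg _) (upEnergy_nonneg _ _))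
    _ ≤ _ := by
        rw [one_mul]
        exact mul_le_mul_of_nonneg_left (upEnergy_le_energyBound_mul x (by omega))
          (Nat.cast_nonneg _)

theorem one_lt_choose {N m : ℕ} (hm : 0 < m) (hN : m < N) : 1 < N.choose m := by
  refine lt_of_le_of_ne' (Nat.choose_pos hN.le) fun h => ?_
  rcases Nat.choose_eq_one_iff.mp h with h | h <;> omega

theorem mainTheorem6 (n k ℓ : ℕ) (hk : Even k) (hk0 : 0 < k) (hkℓ : k / 2 ≤ ℓ)
    (hn : k ^ 2 * ℓ < n)
    (z : Fin n → ℝ) (hz : ∀ i, z i = 1 ∨ z i = -1)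
    (v : LSubset n ℓ → ℝ) (hv : v ⬝ᵥ v = 1) :
    z ⬝ᵥ (votingMatrix v *ᵥ z) ≥
      (n : ℝ) *
        ((v ⬝ᵥ (noiselessKikuchi k ℓ z *ᵥ v) - (-1 : ℝ) ^ (k / 2) * (ℓ.choose (k / 2) : ℝ)) /
          (((n - ℓ).choose (k / 2) : ℝ) * (ℓ.choose (k / 2) : ℝ)
            - (-1 : ℝ) ^ (k / 2) * (ℓ.choose (k / 2) : ℝ)))
        - (ℓ : ℝ) := by
  obtain ⟨m, rfl⟩ := hk.two_dvd
  rw [Nat.mul_div_cancel_left m two_pos] at hkℓ ⊢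
  have hm : 0 < m := by omega
  have hℓ : 1 ≤ ℓ := by omega
  have hsq : 4 * ℓ ≤ (2 * m) ^ 2 * ℓ := Nat.mul_le_mul_right ℓ (by nlinarith)
  obtain ⟨N, rfl⟩ := Nat.exists_eq_add_of_le' (show ℓ ≤ n by omega)
  rw [Nat.add_sub_cancel, dotProduct_votingMatrix_mulVec hz,
    dotProduct_noiselessKikuchi_mulVec m hz]
  set x : LSubset (N + ℓ) ℓ → ℝ := fun U => (∏ i ∈ (U : Finset (Fin (N + ℓ))), z i) * v U with hx
  have hunit : upEnergy x ℓ = 1 := by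
    rw [upEnergy_self, ← hv, dotProduct]
    refine Finset.sum_congr rfl fun U _ => ?_
    have h1 : (∏ i ∈ (U : Finset (Fin (N + ℓ))), z i) ^ 2 = 1 := by
      rw [← Finset.prod_pow]
      refine Finset.prod_eq_one fun i _ => ?_
      rcases hz i with h | h <;> simp [h]
    rw [hx, mul_pow, h1, one_mul, sq]
  have hone : johnsonForm x 1 = upEnergy x (ℓ - 1) - ℓ := by
    rw [johnsonForm_eq_sum_upEnergy hℓ, Finset.sum_range_succ, Finset.sum_range_one]
    simp [hunit]
    ring
  have hle := sum_signed_upEnergy_le hkℓ x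
  rw [hunit, mul_one] at hle
  have hnum := mul_le_mul_of_nonneg_right (mul_sum_energyBound_le hm hkℓ hn)
    (upEnergy_nonneg x (ℓ - 1))
  have hD : 0 < (N.choose m : ℝ) * (ℓ.choose m : ℝ) - (-1 : ℝ) ^ m * (ℓ.choose m : ℝ) := by
    have h1 : (1 : ℝ) < N.choose m := by exact_mod_cast one_lt_choose hm (by omega)
    have h2 : (0 : ℝ) < ℓ.choose m := by exact_mod_cast Nat.choose_pos hkℓ
    have h3 : (-1 : ℝ) ^ m ≤ 1 := by
      rcases neg_one_pow_eq_or ℝ m with h | h <;> norm_num [h]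
    rw [← sub_mul]
    exact mul_pos (by linarith) h2
  rw [hone, ge_iff_le, sub_le_sub_iff_right, mul_div_assoc', div_le_iff₀ hD]
  have hfin := mul_le_mul_of_nonneg_left hle (Nat.cast_nonneg (α := ℝ) (N + ℓ))
  push_cast at hfin ⊢
  linarith
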